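/- All Hilbert spaces are complex. A linear relation $R$ from a Hilbert space $\mathfrak H_1$ to a Hilbert space $\mathfrak H_2$ is a linear subspace of $\mathfrak H_1\times\mathfrak H_2$; it is closed if it is closed in the product topology, $\overline{R}$ denotes its closure, $\operatorname{dom}R=\{f:\{f,f'\}\in R \text{ for some } f'\}$, $\operatorname{mul}R=\{f':\{0,f'\}\in R\}$, and $$R^*=\{\{g,g'\}\in\mathfrak H_2\times\mathfrak H_1:\ (f',g)=(f,g')\ \text{for all } \{f,f'\}\in R\}.$$ Products are $SR=\{\{f,f'\}:\{f,\varphi\}\in R,\ \{\varphi,f'\}\in S\text{ for some }\varphi\}$, and bounded operators are identified with their graphs. For a closed relation $R$ the operator part is $R_{\rm s}=\{\{f,f'\}\in R: f'\perp\operatorname{mul}R\}$. A relation $R$ in $\mathfrak H$ is nonnegative selfadjoint if $R=R^*$ and $(f',f)\ge 0$ for all $\{f,f'\}\in R$; then $R^{1/2}$ denotes the unique nonnegative selfadjoint relation with $(R^{1/2})^2=R$. For nonnegative selfadjoint relations $R_1,R_2$ in $\mathfrak H$ write $R_1\le R_2$ if $$\operatorname{dom}(R_2^{1/2})_{\rm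 s}\subset\operatorname{dom}(R_1^{1/2})_{\rm s}\quad\text{and}\quad \|(R_1^{1/2})_{\rm s}h\|\le\|(R_2^{1/2})_{\rm s}h\|\quad\text{for all } h\in\operatorname{dom}(R_2^{1/2})_{\rm s}.$$ For $r>0$ put $rR=\{\{f,rf'\}:\{f,f'\}\in R\}$, and for $r=0$ put $0R=\overline{\operatorname{dom}}\,R\times\operatorname{mul}R$, so that for every $r\ge 0$ the inequality $R_1\le rR_2$ means $\operatorname{dom}(R_2^{1/2})_{\rm s}\subset\operatorname{dom}(R_1^{1/2})_{\rm s}$ and $\|(R_1^{1/2})_{\rm s}h\|^2\le r\|(R_2^{1/2})_{\rm s}h\|^2$ there. **Corollary.** Let $\mathfrak H_A,\mathfrak H_B,\mathfrak H,\mathfrak K$ be Hilbert spaces, let $A$ be a closed linear relation from $\mathfrak H_A$ to $\mathfrak H$, and let $B$ be a closed linear relation from $\mathfrak H_B$ to $\mathfrak H$. If $c\ge 0$ and $T\in\mathbf B(\mathfrak K,\mathfrak H_A)$ is a bounded everywhere defined operator, then $$AA^*\le c^2BB^*\quad\Rightarrow\quad AT\,\overline{T^*A^*}\le c^2\|T\|^2BB^*.$$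 In particular, $$BT\,\overline{T^*B^*}\le\|T\|^2BB^*$$ holds for every $T\in\mathbf B(\mathfrak K,\mathfrak H_B)$. All relations compared here are nonnegative selfadjoint. -/

import Mathlib

/-- A linear relation from `E` to `F` is a linear subspace of `E × F`. -/
abbrev LinRel (E F : Type*) [AddCommGroup E] [Module ℂ E] [AddCommGroup F] [Module ℂ F] :=
  Submodule ℂ (E × F)

namespace LinRel

section Algebra

variable {E F G : Type*} [AddCommGroup E] [Module ℂ E] [AddCommGroup F] [Module ℂ F]
  [AddCommGroup G] [Module ℂ G]

/-- The domain `{f : {f, f'} ∈ H for some f'}`. -/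
def dom (H : LinRel E F) : Submodule ℂ E := H.map (LinearMap.fst ℂ E F)

/-- The multivalued part `{f' : {0, f'} ∈ H}`. -/
def mul (H : LinRel E F) : Submodule ℂ F := H.comap (LinearMap.inr ℂ E F)

/-- The product `H₂ H₁ = {{f, f'} : {f, φ} ∈ H₁ and {φ, f'} ∈ H₂ for some φ}`. -/
def prod (H₂ : LinRel F G) (H₁ : LinRel E F) : LinRel E G where
  carrier := {p | ∃ φ : F, (p.1, φ) ∈ H₁ ∧ (φ, p.2) ∈ H₂}
  zero_mem' := ⟨0, H₁.zero_mem, H₂.zero_mem⟩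
  add_mem' := by
    rintro p q ⟨φ, h1, h2⟩ ⟨ψ, h3, h4⟩
    exact ⟨φ + ψ, H₁.add_mem h1 h3, H₂.add_mem h2 h4⟩
  smul_mem' := by
    rintro a p ⟨φ, h1, h2⟩
    exact ⟨a • φ, H₁.smul_mem a h1, H₂.smul_mem a h2⟩

end Algebra

section Hilbert

open scoped ComplexOrder

variable {E F : Type*} [NormedAddCommGroup E] [InnerProductSpace ℂ E]
  [NormedAddCommGroup F] [InnerProductSpace ℂ F]

/-- A bounded everywhere defined operator, viewed as a linear relation (its graph). -/
def ofCLM (T : E →L[ℂ] F) : LinRel E F := LinearMap.graph (T : E →ₗ[ℂ] F)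

/-- The operator part `H_s = H ⊖ ({0} × mul H)`: the pairs `{f, f'} ∈ H` with `f' ⊥ mul H`. -/
def opPart (H : LinRel E F) : LinRel E F where
  carrier := {p | p ∈ H ∧ p.2 ∈ (mul H)ᗮ}
  zero_mem' := ⟨H.zero_mem, Submodule.zero_mem _⟩
  add_mem' h k := ⟨H.add_mem h.1 k.1, Submodule.add_mem _ h.2 k.2⟩
  smul_mem' a _ h := ⟨H.smul_mem a h.1, Submodule.smul_mem _ a h.2⟩

/-- `H` is a nonnegative selfadjoint relation: `H = H*` and `(f', f) ≥ 0` for `{f, f'} ∈ H`. -/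
structure IsNonnegSelfAdjoint (H : LinRel E E) : Prop where
  selfAdjoint : H.adjoint = H
  nonneg : ∀ f f' : E, (f, f') ∈ H → 0 ≤ inner ℂ f' f

/-- `K = H^{1/2}`: `K` is nonnegative and selfadjoint, and `K² = H`. -/
structure IsSqrt (K H : LinRel E E) : Prop where
  isNonnegSelfAdjoint : K.IsNonnegSelfAdjoint
  sq_eq : prod K K = H

/-- The order `H₁ ≤ H₂` of nonnegative selfadjoint relations:
`dom (H₂^{1/2})_s ⊆ dom (H₁^{1/2})_s` and `‖(H₁^{1/2})_s h‖ ≤ ‖(H₂^{1/2})_s h‖` for every `h` in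
`dom (H₂^{1/2})_s`. Nonnegative selfadjoint relations have exactly one square root, so that
`K₁`, `K₂` are the square roots of `H₁`, `H₂`. -/
def IsLE (H₁ H₂ : LinRel E E) : Prop :=
  H₁.IsNonnegSelfAdjoint ∧ H₂.IsNonnegSelfAdjoint ∧
    ∃ K₁ K₂ : LinRel E E, IsSqrt K₁ H₁ ∧ IsSqrt K₂ H₂ ∧
      dom (opPart K₂) ≤ dom (opPart K₁) ∧
      ∀ h k₁ k₂ : E, (h, k₁) ∈ opPart K₁ → (h, k₂) ∈ opPart K₂ → ‖k₁‖ ≤ ‖k₂‖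

open Classical in
/-- The multiple `r H` of a nonnegative selfadjoint relation `H` by a scalar `r ≥ 0`. For `r ≠ 0`
this is `{{f, r f'} : {f, f'} ∈ H}`. The set `{{f, 0} : f ∈ dom H}` is in general not selfadjoint;
`0 H` stands for the nonnegative selfadjoint relation whose operator part is the zero operator on
the closure of `dom H` and whose multivalued part is `mul H = (dom H)ᗮ` (the limit of `r H`
for `r ↓ 0` in the strong resolvent sense). Then `H₁ ≤ r H₂` means, for every `r ≥ 0`,
that `dom H₂^{1/2} ⊆ dom H₁^{1/2}` and `‖(H₁^{1/2})_s h‖² ≤ r ‖(H₂^{1/2})_s h‖²` on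
`dom H₂^{1/2}`. -/
noncomputable def scale (r : ℝ) (H : LinRel E E) : LinRel E E :=
  if r = 0 then Submodule.prod (dom H).topologicalClosure (mul H)
  else H.map (LinearMap.prodMap LinearMap.id ((r : ℂ) • LinearMap.id))

end Hilbert

end LinRel

namespace LinRel

open scoped ComplexOrder

variable {E F G : Type*} [NormedAddCommGroup E] [InnerProductSpace ℂ E]
  [NormedAddCommGroup F] [InnerProductSpace ℂ F] [NormedAddCommGroup G] [InnerProductSpace ℂ G]

/-! The nonnegative form of `S S*` is `‖(S*)_s h‖²` on `dom S*`. Hence `S S* ≤ W W*` says exactly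
that every `{h, w} ∈ W*` has a partner `{h, k} ∈ S*` with `‖k‖ ≤ ‖w‖` (`isLE_prod_adjoint_iff`), and
square roots disappear from the problem. Both sides of the claim are products of this kind: the
closure of `T* A*` is `(A T)*`, and `r² B B*` is `(r B)(r B)*` for a suitable reading of `r B`
(`prod_dilate_adjoint`). If `{h, k} ∈ A*`, then `{h, T* k} ∈ (A T)*` with `‖T* k‖ ≤ ‖T‖ ‖k‖`, which
is the estimate. Only `T = 0`, `c ≠ 0` needs a separate argument, since there the scale `0` enlarges
the domain on the right. -/

theorem mk_mem_adjoint {S : LinRel E F} {g : F} {g' : E} :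
    (g, g') ∈ S.adjoint ↔ ∀ f f', (f, f') ∈ S → inner ℂ f' g = inner ℂ f g' := by
  simp [Submodule.mem_adjoint_iff, sub_eq_zero]

theorem mk_mem_prod {R : LinRel F G} {S : LinRel E F} {f : E} {g : G} :
    (f, g) ∈ prod R S ↔ ∃ φ, (f, φ) ∈ S ∧ (φ, g) ∈ R := Iff.rfl

theorem mem_dom {S : LinRel E F} {f : E} : f ∈ dom S ↔ ∃ f', (f, f') ∈ S := by
  simp [dom]

theorem mem_mul {S : LinRel E F} {f' : F} : f' ∈ mul S ↔ (0, f') ∈ S := by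
  simp [mul]

theorem isClosed_mul {S : LinRel E F} (hS : IsClosed (S : Set (E × F))) :
    IsClosed (mul S : Set F) :=
  hS.preimage (Continuous.prodMk_right (0 : E))

theorem isClosed_adjoint (S : LinRel E F) : IsClosed (S.adjoint : Set (F × E)) := by
  have : (S.adjoint : Set (F × E)) =
      ⋂ p : S, {x : F × E | inner ℂ (p : E × F).2 x.1 = inner ℂ (p : E × F).1 x.2} := by
    ext ⟨g, g'⟩
    simp only [SetLike.mem_coe, mk_mem_adjoint, Set.mem_iInter, Set.mem_ofPred_eq, Subtype.forall,
      Prod.forall]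
  rw [this]
  exact isClosed_iInter fun p => isClosed_eq (by fun_prop) (by fun_prop)

theorem isClosed_opPart {S : LinRel E F} (hS : IsClosed (S : Set (E × F))) :
    IsClosed (opPart S : Set (E × F)) :=
  hS.inter ((Submodule.isClosed_orthogonal (mul S)).preimage continuous_snd)

theorem le_adjoint_symm {S : LinRel E F} {R : LinRel F E} (h : S ≤ R.adjoint) :
    R ≤ S.adjoint := by
  rintro ⟨g, g'⟩ hg
  refine mk_mem_adjoint.2 fun f f' hf => ?_
  have := mk_mem_adjoint.1 (h hf) g g' hg
  rw [← inner_conj_symm, ← this, inner_conj_symm]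

theorem le_adjoint_iff {S : LinRel E F} {R : LinRel F E} : S ≤ R.adjoint ↔ R ≤ S.adjoint :=
  ⟨le_adjoint_symm, le_adjoint_symm⟩

theorem inner_self_eq_ofReal (x : E) : inner ℂ x x = ((‖x‖ ^ 2 : ℝ) : ℂ) := by
  rw [inner_self_eq_norm_sq_to_K]
  push_cast
  rfl

theorem inner_self_complex_nonneg (x : E) : (0 : ℂ) ≤ inner ℂ x x := by
  rw [inner_self_eq_ofReal]
  exact Complex.zero_le_real.2 (sq_nonneg _)

/-! ### Operator parts, orthogonal projection, double adjoints -/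

/-- The minimal value of `‖f'‖` over the pairs `{f, f'} ∈ S` is attained at the operator part. -/
theorem norm_le_of_mem_opPart {S : LinRel E F} {f : E} {k y : F} (hk : (f, k) ∈ opPart S)
    (hy : (f, y) ∈ S) : ‖k‖ ≤ ‖y‖ := by
  have hm : y - k ∈ mul S := mem_mul.2 (by simpa using S.sub_mem hy hk.1)
  have h0 : inner ℂ k (y - k) = 0 := (Submodule.mem_orthogonal' _ _).1 hk.2 _ hm
  have := norm_add_sq_eq_norm_sq_add_norm_sq_of_inner_eq_zero k (y - k) h0
  rw [add_sub_cancel] at this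
  nlinarith [norm_nonneg k, norm_nonneg y, mul_self_nonneg ‖y - k‖]

theorem exists_mem_opPart [CompleteSpace F] {S : LinRel E F} (hS : IsClosed (S : Set (E × F)))
    {f : E} {y : F} (hy : (f, y) ∈ S) : ∃ k, (f, k) ∈ opPart S := by
  have : CompleteSpace (mul S) := (isClosed_mul hS).completeSpace_coe
  refine ⟨y - (mul S).starProjection y, ?_, Submodule.sub_starProjection_mem_orthogonal y⟩
  have h := mem_mul.1 (Submodule.starProjection_apply_mem (mul S) y)
  simpa using S.sub_mem hy h

/-- Orthogonal projection onto a closed linear relation, for the Hilbert space structure of the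
product. -/
theorem exists_orthogonal_decomposition [CompleteSpace E] [CompleteSpace F] {S : LinRel E F}
    (hS : IsClosed (S : Set (E × F))) (a : E) (b : F) :
    ∃ x y, (x, y) ∈ S ∧ ∀ f f', (f, f') ∈ S → inner ℂ f (a - x) + inner ℂ f' (b - y) = 0 := by
  let e := WithLp.prodContinuousLinearEquiv 2 ℂ E F
  let S' : Submodule ℂ (WithLp 2 (E × F)) := S.comap (e : WithLp 2 (E × F) →ₗ[ℂ] E × F)
  have hS' : IsClosed (S' : Set (WithLp 2 (E × F))) := hS.preimage e.continuous
  have : CompleteSpace S' := hS'.completeSpace_coe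
  let v := WithLp.toLp 2 (a, b)
  let p := S'.starProjection v
  have hp : p ∈ S' := Submodule.starProjection_apply_mem S' v
  have hq : v - p ∈ S'ᗮ := Submodule.sub_starProjection_mem_orthogonal v
  refine ⟨(WithLp.ofLp p).1, (WithLp.ofLp p).2, hp, fun f f' hf => ?_⟩
  have := (Submodule.mem_orthogonal _ _).1 hq (WithLp.toLp 2 (f, f')) hf
  exact this

/-- The residual of projecting an element of `S**` onto `S` lies in `S**`, and rotated it lies in
`S*`; pairing the two forces its norm to vanish. -/
theorem adjoint_adjoint [CompleteSpace E] [CompleteSpace F] {S : LinRel E F}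
    (hS : IsClosed (S : Set (E × F))) : S.adjoint.adjoint = S := by
  refine le_antisymm ?_ (le_adjoint_iff.2 le_rfl)
  rintro ⟨a, b⟩ hab
  obtain ⟨x, y, hxy, horth⟩ := exists_orthogonal_decomposition hS a b
  have hadj : (b - y, -(a - x)) ∈ S.adjoint := mk_mem_adjoint.2 fun f f' hf => by
    rw [inner_neg_right, eq_neg_iff_add_eq_zero, add_comm]
    exact horth f f' hf
  have hmem : (a - x, b - y) ∈ S.adjoint.adjoint :=
    S.adjoint.adjoint.sub_mem hab ((le_adjoint_iff.2 le_rfl : S ≤ S.adjoint.adjoint) hxy)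
  have h := mk_mem_adjoint.1 hmem _ _ hadj
  rw [inner_neg_left, neg_eq_iff_add_eq_zero, inner_self_eq_ofReal, inner_self_eq_ofReal] at h
  have h' : ‖a - x‖ ^ 2 + ‖b - y‖ ^ 2 = 0 := by exact_mod_cast h
  have h1 : a - x = 0 := norm_eq_zero.1 (by nlinarith [norm_nonneg (a - x), norm_nonneg (b - y)])
  have h2 : b - y = 0 := norm_eq_zero.1 (by nlinarith [norm_nonneg (a - x), norm_nonneg (b - y)])
  rw [sub_eq_zero.1 h1, sub_eq_zero.1 h2]
  exact hxy

theorem adjoint_topologicalClosure (S : LinRel E F) :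
    S.topologicalClosure.adjoint = S.adjoint := by
  refine le_antisymm (le_adjoint_iff.1 ?_) (le_adjoint_iff.1 ?_)
  · exact S.le_topologicalClosure.trans (le_adjoint_iff.2 le_rfl)
  · exact S.topologicalClosure_minimal (le_adjoint_iff.2 le_rfl) (isClosed_adjoint _)

theorem topologicalClosure_eq_adjoint_adjoint [CompleteSpace E] [CompleteSpace F]
    (S : LinRel E F) : S.topologicalClosure = S.adjoint.adjoint := by
  rw [← adjoint_topologicalClosure S, adjoint_adjoint S.isClosed_topologicalClosure]

/-! ### Selfadjointness and square roots of `S S*` -/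

/-- The range of `1 + S S*` is the whole space. -/
theorem exists_resolvent [CompleteSpace E] [CompleteSpace F] {S : LinRel E F}
    (hS : IsClosed (S : Set (E × F))) (u : F) :
    ∃ d ψ, (d, ψ) ∈ S.adjoint ∧ (ψ, u - d) ∈ S := by
  -- Project `{0, u}` onto `S`: the residual `{-x, u - y}` is orthogonal to `S`, that is, `{u - y,
  -- x} ∈ S*`.
  obtain ⟨x, y, hxy, horth⟩ := exists_orthogonal_decomposition hS 0 u
  refine ⟨u - y, x, mk_mem_adjoint.2 fun f f' hf => ?_, by simpa using hxy⟩
  have := horth f f' hf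
  rw [zero_sub, inner_neg_right, neg_add_eq_zero] at this
  exact this.symm

/-- `M = S S*` is symmetric with `ran (1 + M)` the whole space, so `ker (1 + M*) = 0`. An element of
`M*` therefore equals the element of `M` with the same sum of components. -/
theorem isNonnegSelfAdjoint_prod_adjoint [CompleteSpace E] [CompleteSpace F] {S : LinRel E F}
    (hS : IsClosed (S : Set (E × F))) : (prod S S.adjoint).IsNonnegSelfAdjoint where
  selfAdjoint := by
    have hsymm : prod S S.adjoint ≤ (prod S S.adjoint).adjoint := by
      rintro ⟨d, w⟩ ⟨ψ, h1, h2⟩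
      refine mk_mem_adjoint.2 ?_
      rintro e v ⟨χ, h3, h4⟩
      rw [mk_mem_adjoint.1 h1 _ _ h4, ← inner_conj_symm, ← mk_mem_adjoint.1 h3 _ _ h2,
        inner_conj_symm]
    refine le_antisymm ?_ hsymm
    rintro ⟨g, g'⟩ hg
    obtain ⟨d, ψ, h1, h2⟩ := exists_resolvent hS (g + g')
    have hd : (d, g + g' - d) ∈ prod S S.adjoint := ⟨ψ, h1, h2⟩
    have hx := (prod S S.adjoint).adjoint.sub_mem hg (hsymm hd)
    have hx' : (g - d, -(g - d)) ∈ (prod S S.adjoint).adjoint := by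
      convert hx using 1
      ext <;> simp; abel
    obtain ⟨e, χ, h3, h4⟩ := exists_resolvent hS (g - d)
    have h := mk_mem_adjoint.1 hx' e (g - d - e) ⟨χ, h3, h4⟩
    rw [inner_neg_right, eq_neg_iff_add_eq_zero, ← inner_add_left, sub_add_cancel,
      inner_self_eq_zero, sub_eq_zero] at h
    rw [← h] at hd
    simpa using hd
  nonneg := by
    rintro f f' ⟨φ, h1, h2⟩
    rw [mk_mem_adjoint.1 h1 _ _ h2]
    exact inner_self_complex_nonneg φ

/-- A bounded operator `R` with `0 ≤ R ≤ 1` gives the nonnegative selfadjoint relation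
`R⁻¹ - 1 = {{R u, u - R u}}`, whose square root is `{{R^{1/2} u, (1 - R)^{1/2} u}}`. -/
theorem exists_isSqrt_of_resolvent [CompleteSpace E] {M : LinRel E E} (R : E →L[ℂ] E)
    (hR0 : 0 ≤ R) (hR1 : R ≤ 1) (hM : ∀ f f', (f, f') ∈ M ↔ ∃ u, R u = f ∧ u - R u = f') :
    ∃ K, IsSqrt K M := by
  have hsa : IsSelfAdjoint R := .of_nonneg hR0
  have hspec0 : ∀ x ∈ spectrum ℝ R, 0 ≤ x := fun x hx => spectrum_nonneg_of_nonneg hR0 hx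
  have hspec1 : ∀ x ∈ spectrum ℝ R, x ≤ 1 :=
    (le_algebraMap_iff_spectrum_le (r := (1 : ℝ)) (a := R)).1 (by simpa using hR1)
  let P := cfc Real.sqrt R
  let Q := cfc (fun x : ℝ => Real.sqrt (1 - x)) R
  have hP : IsSelfAdjoint P := cfc_predicate _ R
  have hQ : IsSelfAdjoint Q := cfc_predicate _ R
  have hPP : P * P = R := by
    rw [← cfc_mul .., cfc_congr (g := fun x => x) fun x hx => Real.mul_self_sqrt (hspec0 x hx),
      cfc_id' ℝ R]
  have hQQ : Q * Q = 1 - R := by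
    rw [← cfc_mul .., cfc_congr (g := fun x => 1 - x) fun x hx =>
      Real.mul_self_sqrt (sub_nonneg.2 (hspec1 x hx)), cfc_sub .., cfc_const_one ℝ R, cfc_id' ℝ R]
  have hPQ : P * Q = Q * P := (cfc_commute_cfc _ _ R).eq
  have hPQ0 : 0 ≤ P * Q := by
    rw [← cfc_mul ..]
    exact cfc_nonneg fun x _ => mul_nonneg (Real.sqrt_nonneg _) (Real.sqrt_nonneg _)
  have ePP : ∀ u, P (P u) = R u := fun u => congr($hPP u)
  have eQQ : ∀ u, Q (Q u) = u - R u := fun u => congr($hQQ u)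
  have ePQ : ∀ u, P (Q u) = Q (P u) := fun u => congr($hPQ u)
  have sP : ∀ u v, inner ℂ (P u) v = inner ℂ u (P v) := hP.isSymmetric
  have sQ : ∀ u v, inner ℂ (Q u) v = inner ℂ u (Q v) := hQ.isSymmetric
  let K : LinRel E E := LinearMap.range ((P : E →ₗ[ℂ] E).prod (Q : E →ₗ[ℂ] E))
  have hK : ∀ f f', (f, f') ∈ K ↔ ∃ u, P u = f ∧ Q u = f' := fun f f' => by
    simp [K]
  -- The range `K` is also the solution set of `Q g = P g'`, which describes `K*`. The witness works
  -- because `P² + Q² = 1`.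
  have solve : ∀ g g', Q g = P g' → ∃ u, P u = g ∧ Q u = g' := fun g g' h =>
    ⟨P g + Q g', by simp [ePP, ePQ, ← h, eQQ], by simp [← ePQ, h, ePP, eQQ]⟩
  refine ⟨K, ⟨?_, ?_⟩, ?_⟩
  · ext ⟨g, g'⟩
    rw [mk_mem_adjoint, hK]
    constructor
    · intro h
      refine solve g g' (ext_inner_left ℂ fun v => ?_)
      rw [← sQ, ← sP]
      exact h _ _ ((hK _ _).2 ⟨v, rfl, rfl⟩)
    · rintro ⟨u, rfl, rfl⟩ f f' hf
      obtain ⟨v, rfl, rfl⟩ := (hK _ _).1 hf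
      rw [sP, sQ, ePQ]
  · intro f f' hf
    obtain ⟨u, rfl, rfl⟩ := (hK _ _).1 hf
    rw [← sP]
    exact ((ContinuousLinearMap.nonneg_iff_isPositive _).1 hPQ0).inner_nonneg_left u
  · ext ⟨f, f'⟩
    rw [mk_mem_prod, hM]
    constructor
    · rintro ⟨φ, h1, h2⟩
      obtain ⟨u, rfl, rfl⟩ := (hK _ _).1 h1
      obtain ⟨w, hw, rfl⟩ := (hK _ _).1 h2
      obtain ⟨v, rfl, rfl⟩ := solve u w hw.symm
      exact ⟨v, (ePP v).symm, (eQQ v).symm⟩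
    · rintro ⟨v, rfl, rfl⟩
      exact ⟨Q (P v), (hK _ _).2 ⟨P v, ePP v, rfl⟩, (hK _ _).2 ⟨Q v, ePQ v, eQQ v⟩⟩

/-- Nonnegativity makes `(1 + M)⁻¹`, which sends `u` to the `d` with `{d, u - d} ∈ M`, a
single-valued operator between `0` and `1`. -/
theorem exists_isSqrt_prod_adjoint [CompleteSpace E] [CompleteSpace F] {S : LinRel E F}
    (hS : IsClosed (S : Set (E × F))) : ∃ K, IsSqrt K (prod S S.adjoint) := by
  set M := prod S S.adjoint with hMdef
  have hM := isNonnegSelfAdjoint_prod_adjoint hS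
  have hex : ∀ u, ∃ d, (d, u - d) ∈ M := fun u =>
    let ⟨d, ψ, h⟩ := exists_resolvent hS u
    ⟨d, ψ, h⟩
  have huniq : ∀ {u d d'}, (d, u - d) ∈ M → (d', u - d') ∈ M → d = d' := by
    intro u d d' h h'
    have hx : (d - d', -(d - d')) ∈ M := by
      convert M.sub_mem h h' using 1
      ext <;> simp
    have h0 := hM.nonneg _ _ hx
    rw [inner_neg_left, inner_self_eq_ofReal, ← Complex.ofReal_neg, Complex.zero_le_real] at h0
    exact sub_eq_zero.1 (norm_eq_zero.1 (by nlinarith [norm_nonneg (d - d')]))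
  choose r hr using hex
  have hre : ∀ d w, (d, w) ∈ M → 0 ≤ RCLike.re (inner ℂ w d) := fun d w h =>
    (RCLike.nonneg_iff.1 (hM.nonneg d w h)).1
  let Rl : F →ₗ[ℂ] F :=
    { toFun := r
      map_add' := fun u v => huniq (hr _) (by
        convert M.add_mem (hr u) (hr v) using 1
        ext <;> simp; abel)
      map_smul' := fun c u => huniq (hr _) (by
        convert M.smul_mem c (hr u) using 1
        ext <;> simp [smul_sub]) }
  let R : F →L[ℂ] F := Rl.mkContinuous 1 fun u => by
    have h1 := hre _ _ (hr u)
    have h2 : ‖u‖ ^ 2 = ‖u - r u‖ ^ 2 + 2 * RCLike.re (inner ℂ (u - r u) (r u)) + ‖r u‖ ^ 2 := by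
      rw [← norm_add_sq, sub_add_cancel]
    have h3 : ‖r u‖ ^ 2 ≤ ‖u‖ ^ 2 := by nlinarith [sq_nonneg ‖u - r u‖]
    rw [one_mul]
    exact le_of_sq_le_sq h3 (norm_nonneg u)
  have hRr : ∀ u, R u = r u := fun u => rfl
  have hpos : ∀ T : F →L[ℂ] F, (∀ u, 0 ≤ inner ℂ (T u) u) → T.IsPositive := fun T h =>
    (ContinuousLinearMap.isPositive_iff_complex T).2 fun u =>
      ⟨RCLike.ext (by simp) (by simpa using (RCLike.nonneg_iff.1 (h u)).2.symm),
        (RCLike.nonneg_iff.1 (h u)).1⟩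
  have hswap : ∀ u, 0 ≤ inner ℂ (r u) (u - r u) := fun u => by
    have := hM.nonneg _ _ (hr u)
    rw [← inner_conj_symm]
    exact star_nonneg_iff.2 this
  refine exists_isSqrt_of_resolvent R ?_ ?_ fun f f' => ⟨fun h => ?_, ?_⟩
  · refine (ContinuousLinearMap.nonneg_iff_isPositive _).2 (hpos _ fun u => ?_)
    rw [hRr, ← sub_add_cancel (inner ℂ (r u) u) (inner ℂ (r u) (r u)), ← inner_sub_right]
    exact add_nonneg (hswap u) (inner_self_complex_nonneg _)
  · refine (ContinuousLinearMap.le_def _ _).2 (hpos _ fun u => ?_)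
    rw [sub_apply, one_apply_eq_self, hRr,
      ← sub_add_cancel (inner ℂ (u - r u) u) (inner ℂ (u - r u) (u - r u)), ← inner_sub_right,
      sub_sub_cancel]
    exact add_nonneg (hM.nonneg _ _ (hr u)) (inner_self_complex_nonneg _)
  · have hf : R (f + f') = f := huniq (hr (f + f')) (by simpa using h)
    exact ⟨f + f', hf, by rw [hf, add_sub_cancel_left]⟩
  · rintro ⟨u, rfl, rfl⟩
    exact hr u

/-! ### The form of `S S*` and the order -/

/-- `dom S S*` is a core of the operator part of `S*`. -/
theorem opPart_adjoint_le_closure [CompleteSpace E] [CompleteSpace F] {S : LinRel E F}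
    (hS : IsClosed (S : Set (E × F))) :
    opPart S.adjoint ≤
      (S.adjoint ⊓ (dom S).comap (LinearMap.snd ℂ F E)).topologicalClosure := by
  set L := S.adjoint ⊓ (dom S).comap (LinearMap.snd ℂ F E)
  have hL : L ≤ opPart S.adjoint := by
    rintro ⟨d, ψ⟩ ⟨h1, h2⟩
    obtain ⟨w, hw⟩ := mem_dom.1 h2
    refine ⟨h1, (Submodule.mem_orthogonal' _ _).2 fun m hm => ?_⟩
    simpa using (mk_mem_adjoint.1 (mem_mul.1 hm) _ _ hw).symm
  rintro ⟨h, s⟩ hs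
  obtain ⟨x, y, hxy, horth⟩ :=
    exists_orthogonal_decomposition L.isClosed_topologicalClosure h s
  have hq : (h - x, s - y) ∈ opPart S.adjoint := (opPart S.adjoint).sub_mem hs
    (L.topologicalClosure_minimal hL (isClosed_opPart (isClosed_adjoint S)) hxy)
  -- Testing the residual against this element of `L` gives `‖h - x‖² = 0`; then `s - y` lies in
  -- `mul S*` and in its orthogonal complement.
  obtain ⟨d, ψ, h1, h2⟩ := exists_resolvent hS (h - x)
  have h3 := horth d ψ (L.le_topologicalClosure ⟨h1, mem_dom.2 ⟨_, h2⟩⟩)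
  rw [← mk_mem_adjoint.1 hq.1 _ _ h2, ← inner_add_left, add_sub_cancel, inner_self_eq_zero] at h3
  have hm : s - y ∈ mul S.adjoint := mem_mul.2 (h3 ▸ hq.1)
  have h4 : s - y = 0 := inner_self_eq_zero.1 ((Submodule.mem_orthogonal _ _).1 hq.2 _ hm)
  rw [sub_eq_zero.1 h3, sub_eq_zero.1 h4]
  exact hxy

/-- The form of `S S*` determines `S*` up to an isometry of the values. -/
theorem exists_mem_adjoint_norm_eq [CompleteSpace E] [CompleteSpace F] [CompleteSpace G]
    {S : LinRel E F} {K : LinRel G F} (hS : IsClosed (S : Set (E × F)))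
    (hSK : prod S S.adjoint = prod K K.adjoint) {h : F} {s : E}
    (hs : (h, s) ∈ opPart S.adjoint) : ∃ k, (h, k) ∈ K.adjoint ∧ ‖k‖ = ‖s‖ := by
  have hcl := opPart_adjoint_le_closure hS hs
  obtain ⟨x, hx, hlim⟩ := mem_closure_iff_seq_limit.1 hcl
  have hstep : ∀ p ∈ S.adjoint ⊓ (dom S).comap (LinearMap.snd ℂ F E),
      ∃ χ, (p.1, χ) ∈ K.adjoint ⊓ (dom K).comap (LinearMap.snd ℂ F G) := by
    rintro ⟨d, ψ⟩ ⟨h1, h2⟩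
    obtain ⟨w, hw⟩ := mem_dom.1 h2
    have : (d, w) ∈ prod K K.adjoint := hSK ▸ ⟨ψ, h1, hw⟩
    obtain ⟨χ, h3, h4⟩ := this
    exact ⟨χ, h3, mem_dom.2 ⟨w, h4⟩⟩
  have hnorm : ∀ d ψ χ, (d, ψ) ∈ S.adjoint ⊓ (dom S).comap (LinearMap.snd ℂ F E) →
      (d, χ) ∈ K.adjoint ⊓ (dom K).comap (LinearMap.snd ℂ F G) → ‖χ‖ = ‖ψ‖ := by
    rintro d ψ χ ⟨h1, h2⟩ ⟨h3, h4⟩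
    obtain ⟨w, hw⟩ := mem_dom.1 h2
    -- `χ'` may a priori differ from `χ`, but pairing with `{χ, v} ∈ K` gives `(χ, χ') = (v, d) =
    -- (χ, χ)`.
    obtain ⟨χ', h5, h6⟩ : (d, w) ∈ prod K K.adjoint := hSK ▸ ⟨ψ, h1, hw⟩
    obtain ⟨v, hv⟩ := mem_dom.1 h4
    have e1 : inner ℂ ψ ψ = inner ℂ w d := (mk_mem_adjoint.1 h1 _ _ hw).symm
    have e2 : inner ℂ χ' χ = inner ℂ w d := (mk_mem_adjoint.1 h3 _ _ h6).symm
    have e3 : inner ℂ χ χ = inner ℂ v d := (mk_mem_adjoint.1 h3 _ _ hv).symm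
    have e4 : inner ℂ χ χ' = inner ℂ v d := (mk_mem_adjoint.1 h5 _ _ hv).symm
    have e5 : inner ℂ χ' χ = inner ℂ χ χ := by
      rw [← inner_conj_symm, e4, ← e3, inner_conj_symm]
    have : inner ℂ χ χ = inner ℂ ψ ψ := by rw [← e5, e2, e1]
    rw [inner_self_eq_ofReal, inner_self_eq_ofReal] at this
    have h' : ‖χ‖ ^ 2 = ‖ψ‖ ^ 2 := by exact_mod_cast this
    exact (sq_eq_sq₀ (norm_nonneg _) (norm_nonneg _)).1 h'
  choose χ hχ using fun n => hstep (x n) (hx n)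
  have hx1 : Filter.Tendsto (fun n => (x n).1) .atTop (nhds h) := hlim.fst_nhds
  have hx2 : Filter.Tendsto (fun n => (x n).2) .atTop (nhds s) := hlim.snd_nhds
  -- Differences stay in the two subspaces, so the norm equality transfers the Cauchy property from
  -- the `S*` values.
  have hcau : CauchySeq χ := by
    have hc := hx2.cauchySeq
    rw [Metric.cauchySeq_iff] at hc ⊢
    intro ε hε
    obtain ⟨N, hN⟩ := hc ε hε
    refine ⟨N, fun m hm n hn => ?_⟩
    have := hN m hm n hn
    rw [dist_eq_norm] at this ⊢
    rwa [hnorm _ _ _ (Submodule.sub_mem _ (hx m) (hx n)) (Submodule.sub_mem _ (hχ m) (hχ n))]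
  obtain ⟨k, hk⟩ := cauchySeq_tendsto_of_complete hcau
  refine ⟨k, ?_, ?_⟩
  · exact (isClosed_adjoint K).mem_of_tendsto (hx1.prodMk_nhds hk)
      (Filter.Eventually.of_forall fun n => (hχ n).1)
  · refine tendsto_nhds_unique hk.norm ?_
    simp_rw [fun n => hnorm _ _ _ (hx n) (hχ n)]
    exact hx2.norm

/-- From `K = K*` follows `K K* = K² = S S*`, so the forms agree. This holds for any square root, so
uniqueness is not needed. -/
theorem IsSqrt.exists_mem_opPart_of_mem_adjoint [CompleteSpace E] [CompleteSpace F]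
    {S : LinRel E F} {K : LinRel F F} (hS : IsClosed (S : Set (E × F)))
    (hK : IsSqrt K (prod S S.adjoint)) {h : F} {s : E} (hs : (h, s) ∈ S.adjoint) :
    ∃ k, (h, k) ∈ opPart K ∧ ‖k‖ ≤ ‖s‖ := by
  have hKa := hK.isNonnegSelfAdjoint.selfAdjoint
  obtain ⟨s', hs'⟩ := exists_mem_opPart (isClosed_adjoint S) hs
  obtain ⟨k, hk, hks⟩ := exists_mem_adjoint_norm_eq (K := K) hS (by rw [hKa, hK.sq_eq]) hs'
  rw [hKa] at hk
  obtain ⟨k', hk'⟩ := exists_mem_opPart (hKa ▸ isClosed_adjoint K) hk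
  exact ⟨k', hk', (norm_le_of_mem_opPart hk' hk).trans
    (hks.le.trans (norm_le_of_mem_opPart hs' hs))⟩

theorem IsSqrt.exists_mem_adjoint_of_mem_opPart [CompleteSpace E] [CompleteSpace F]
    {S : LinRel E F} {K : LinRel F F} (hK : IsSqrt K (prod S S.adjoint)) {h k : F}
    (hk : (h, k) ∈ opPart K) : ∃ s, (h, s) ∈ S.adjoint ∧ ‖s‖ ≤ ‖k‖ := by
  have hKa := hK.isNonnegSelfAdjoint.selfAdjoint
  obtain ⟨s, hs, hsk⟩ := exists_mem_adjoint_norm_eq (S := K) (K := S)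
    (hKa ▸ isClosed_adjoint K) (by rw [hKa, hK.sq_eq]) (by rwa [hKa])
  exact ⟨s, hs, hsk.le⟩

/-- The order of the relations `S S*` and `W W*` expressed by `S*` and `W*`. -/
theorem isLE_prod_adjoint_iff [CompleteSpace E] [CompleteSpace F] [CompleteSpace G]
    {S : LinRel E F} {W : LinRel G F} (hS : IsClosed (S : Set (E × F)))
    (hW : IsClosed (W : Set (G × F))) :
    IsLE (prod S S.adjoint) (prod W W.adjoint) ↔
      ∀ h w, (h, w) ∈ W.adjoint → ∃ k, (h, k) ∈ S.adjoint ∧ ‖k‖ ≤ ‖w‖ := by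
  constructor
  · rintro ⟨-, -, K₁, K₂, hK₁, hK₂, hdom, hle⟩ h w hw
    obtain ⟨k₂, hk₂, hk₂w⟩ := hK₂.exists_mem_opPart_of_mem_adjoint hW hw
    obtain ⟨k₁, hk₁⟩ := mem_dom.1 (hdom (mem_dom.2 ⟨k₂, hk₂⟩))
    obtain ⟨s, hs, hsk⟩ := hK₁.exists_mem_adjoint_of_mem_opPart hk₁
    exact ⟨s, hs, hsk.trans ((hle h k₁ k₂ hk₁ hk₂).trans hk₂w)⟩
  · intro H
    obtain ⟨K₁, hK₁⟩ := exists_isSqrt_prod_adjoint hS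
    obtain ⟨K₂, hK₂⟩ := exists_isSqrt_prod_adjoint hW
    have key : ∀ h k₂, (h, k₂) ∈ opPart K₂ → ∃ k₁, (h, k₁) ∈ opPart K₁ ∧ ‖k₁‖ ≤ ‖k₂‖ := by
      intro h k₂ hk₂
      obtain ⟨w, hw, hwk⟩ := hK₂.exists_mem_adjoint_of_mem_opPart hk₂
      obtain ⟨s, hs, hsw⟩ := H h w hw
      obtain ⟨k₁, hk₁, hks⟩ := hK₁.exists_mem_opPart_of_mem_adjoint hS hs
      exact ⟨k₁, hk₁, hks.trans (hsw.trans hwk)⟩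
    refine ⟨isNonnegSelfAdjoint_prod_adjoint hS, isNonnegSelfAdjoint_prod_adjoint hW,
      K₁, K₂, hK₁, hK₂, fun h hh => ?_, fun h k₁ k₂ hk₁ hk₂ => ?_⟩
    · obtain ⟨k₂, hk₂⟩ := mem_dom.1 hh
      obtain ⟨k₁, hk₁, -⟩ := key h k₂ hk₂
      exact mem_dom.2 ⟨k₁, hk₁⟩
    · obtain ⟨k, hk, hle⟩ := key h k₂ hk₂
      exact (norm_le_of_mem_opPart hk₁ hk.1).trans hle

/-! ### Scalar multiples -/

/-- The relation `s S = {{f, s f'} : {f, f'} ∈ S}` for `s ≠ 0`, and `E × mul S` for `s = 0`. -/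
noncomputable def dilate (s : ℝ) (S : LinRel E F) : LinRel E F :=
  if s = 0 then Submodule.prod ⊤ (mul S)
  else S.comap (LinearMap.prodMap LinearMap.id ((s⁻¹ : ℂ) • LinearMap.id))

theorem mk_mem_dilate {s : ℝ} (hs : s ≠ 0) {S : LinRel E F} {f : E} {f' : F} :
    (f, f') ∈ dilate s S ↔ (f, (s⁻¹ : ℂ) • f') ∈ S := by
  simp [dilate, hs]

theorem mk_mem_dilate_zero {S : LinRel E F} {f : E} {f' : F} :
    (f, f') ∈ dilate 0 S ↔ f' ∈ mul S := by
  simp [dilate]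

theorem isClosed_dilate (s : ℝ) {S : LinRel E F} (hS : IsClosed (S : Set (E × F))) :
    IsClosed (dilate s S : Set (E × F)) := by
  by_cases hs : s = 0
  · subst hs
    have : (dilate 0 S : Set (E × F)) = Prod.snd ⁻¹' (mul S : Set F) := by
      ext ⟨f, f'⟩
      exact mk_mem_dilate_zero
    rw [this]
    exact (isClosed_mul hS).preimage continuous_snd
  · have : (dilate s S : Set (E × F)) = (fun p => (p.1, (s⁻¹ : ℂ) • p.2)) ⁻¹' (S : Set (E × F)) := by
      ext ⟨f, f'⟩
      exact mk_mem_dilate hs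
    rw [this]
    exact hS.preimage (by fun_prop)

theorem mk_mem_adjoint_dilate {s : ℝ} (hs : s ≠ 0) {S : LinRel E F} {g : F} {g' : E} :
    (g, g') ∈ (dilate s S).adjoint ↔ (g, (s⁻¹ : ℂ) • g') ∈ S.adjoint := by
  have hs' : (s : ℂ) ≠ 0 := Complex.ofReal_ne_zero.2 hs
  rw [mk_mem_adjoint, mk_mem_adjoint]
  refine forall_congr' fun f => ⟨fun h f' hf => ?_, fun h f' hf => ?_⟩
  · have := h ((s : ℂ) • f') ((mk_mem_dilate hs).2 (by rwa [inv_smul_smul₀ hs']))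
    rw [inner_smul_left, Complex.conj_ofReal] at this
    rw [inner_smul_right, ← this, inv_mul_cancel_left₀ hs']
  · have := h _ ((mk_mem_dilate hs).1 hf)
    rw [inner_smul_left, inner_smul_right, ← Complex.ofReal_inv, Complex.conj_ofReal] at this
    exact mul_left_cancel₀ (by simpa using hs) this

theorem mk_mem_adjoint_dilate_zero {S : LinRel E F} {g : F} {g' : E} :
    (g, g') ∈ (dilate 0 S).adjoint ↔ g ∈ (mul S)ᗮ ∧ g' = 0 := by
  rw [mk_mem_adjoint, Submodule.mem_orthogonal]
  constructor
  · intro h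
    refine ⟨fun m hm => ?_, ?_⟩
    · simpa using h 0 m (mk_mem_dilate_zero.2 hm)
    · simpa using (h g' 0 (mk_mem_dilate_zero.2 (zero_mem _))).symm
  · rintro ⟨h, rfl⟩ f f' hf
    simpa using h f' (mk_mem_dilate_zero.1 hf)

theorem mem_mul_adjoint {S : LinRel E F} {g : E} : g ∈ mul S.adjoint ↔ g ∈ (dom S)ᗮ := by
  rw [mem_mul, mk_mem_adjoint, Submodule.mem_orthogonal]
  constructor
  · intro h f hf
    obtain ⟨f', hf'⟩ := mem_dom.1 hf
    simpa using (h f f' hf').symm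
  · intro h f f' hf
    simpa using (h f (mem_dom.2 ⟨f', hf⟩)).symm

theorem mul_prod_adjoint (S : LinRel E F) : mul (prod S S.adjoint) = mul S := by
  ext f'
  rw [mem_mul, mem_mul, mk_mem_prod]
  constructor
  · rintro ⟨φ, h1, h2⟩
    have : φ = 0 := by
      simpa using (mk_mem_adjoint.1 h1 _ _ h2).symm
    exact this ▸ h2
  · intro h
    exact ⟨0, zero_mem _, h⟩

/-- For `s = 0` both sides are `(mul S)ᗮ × mul S`: selfadjointness of `S S*` identifies the closure
of its domain with `(mul S)ᗮ`. -/
theorem prod_dilate_adjoint [CompleteSpace E] [CompleteSpace F] {S : LinRel E F}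
    (hS : IsClosed (S : Set (E × F))) (s : ℝ) :
    prod (dilate s S) (dilate s S).adjoint = scale (s ^ 2) (prod S S.adjoint) := by
  by_cases hs : s = 0
  · subst hs
    have hsa := (isNonnegSelfAdjoint_prod_adjoint hS).selfAdjoint
    have hdom : (dom (prod S S.adjoint)).topologicalClosure = (mul S)ᗮ := by
      rw [← Submodule.orthogonal_orthogonal_eq_closure, ← mul_prod_adjoint S]
      congr 1
      ext g
      rw [← mem_mul_adjoint, hsa]
    ext ⟨h, h'⟩
    rw [scale, if_pos (by simp), Submodule.mem_prod, hdom, mul_prod_adjoint, mk_mem_prod]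
    constructor
    · rintro ⟨φ, h1, h2⟩
      exact ⟨(mk_mem_adjoint_dilate_zero.1 h1).1, mk_mem_dilate_zero.1 h2⟩
    · rintro ⟨h1, h2⟩
      exact ⟨0, mk_mem_adjoint_dilate_zero.2 ⟨h1, rfl⟩, mk_mem_dilate_zero.2 h2⟩
  · have hs' : (s : ℂ) ≠ 0 := Complex.ofReal_ne_zero.2 hs
    ext ⟨h, h'⟩
    rw [scale, if_neg (pow_ne_zero 2 hs), mk_mem_prod, Submodule.mem_map]
    constructor
    · rintro ⟨φ, h1, h2⟩
      rw [mk_mem_adjoint_dilate hs] at h1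
      rw [mk_mem_dilate hs] at h2
      refine ⟨(h, (s⁻¹ : ℂ) • (s⁻¹ : ℂ) • h'), ⟨(s⁻¹ : ℂ) • φ, h1, ?_⟩, ?_⟩
      · simpa using S.smul_mem (s⁻¹ : ℂ) h2
      · simp only [LinearMap.prodMap_apply, LinearMap.id_apply, LinearMap.smul_apply,
          pow_two, Complex.ofReal_mul, mul_smul, smul_inv_smul₀ hs']
    · rintro ⟨⟨d, w⟩, ⟨ψ, h1, h2⟩, heq⟩
      obtain ⟨rfl, rfl⟩ := Prod.mk.inj heq
      refine ⟨(s : ℂ) • ψ, (mk_mem_adjoint_dilate hs).2 ?_, (mk_mem_dilate hs).2 ?_⟩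
      · simpa [smul_smul, hs'] using h1
      · simpa [pow_two, smul_smul, hs'] using S.smul_mem (s : ℂ) h2

/-! ### Products with a bounded operator and the main estimate -/

theorem mk_mem_prod_ofCLM {A : LinRel F G} {T : E →L[ℂ] F} {f : E} {g : G} :
    (f, g) ∈ prod A (ofCLM T) ↔ (T f, g) ∈ A := by
  simp [mk_mem_prod, ofCLM, LinearMap.mem_graph_iff]

theorem mk_mem_ofCLM_prod {A : LinRel E F} {T : F →L[ℂ] G} {f : E} {g : G} :
    (f, g) ∈ prod (ofCLM T) A ↔ ∃ φ, (f, φ) ∈ A ∧ g = T φ := by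
  simp [mk_mem_prod, ofCLM, LinearMap.mem_graph_iff]

theorem isClosed_prod_ofCLM {A : LinRel F G} (hA : IsClosed (A : Set (F × G))) (T : E →L[ℂ] F) :
    IsClosed (prod A (ofCLM T) : Set (E × G)) := by
  have : (prod A (ofCLM T) : Set (E × G)) = (fun p => (T p.1, p.2)) ⁻¹' (A : Set (F × G)) := by
    ext ⟨f, g⟩
    exact mk_mem_prod_ofCLM
  rw [this]
  exact hA.preimage (by fun_prop)

theorem adjoint_ofCLM_prod_adjoint [CompleteSpace E] [CompleteSpace F] [CompleteSpace G]
    {A : LinRel F G} (hA : IsClosed (A : Set (F × G))) (T : E →L[ℂ] F) :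
    (prod (ofCLM (ContinuousLinearMap.adjoint T)) A.adjoint).adjoint = prod A (ofCLM T) := by
  ext ⟨k, y⟩
  have hA' : (T k, y) ∈ A ↔ (T k, y) ∈ A.adjoint.adjoint := by rw [adjoint_adjoint hA]
  rw [mk_mem_prod_ofCLM, hA', mk_mem_adjoint, mk_mem_adjoint]
  constructor
  · intro h f f' hf
    have := h f _ (mk_mem_ofCLM_prod.2 ⟨f', hf, rfl⟩)
    rwa [ContinuousLinearMap.adjoint_inner_left] at this
  · intro h f f' hf
    obtain ⟨φ, hφ, rfl⟩ := mk_mem_ofCLM_prod.1 hf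
    rw [ContinuousLinearMap.adjoint_inner_left]
    exact h f φ hφ

/-- `(A T)*` is the closure of `T* A*`. -/
theorem topologicalClosure_ofCLM_prod_adjoint [CompleteSpace E] [CompleteSpace F]
    [CompleteSpace G] {A : LinRel F G} (hA : IsClosed (A : Set (F × G))) (T : E →L[ℂ] F) :
    (prod (ofCLM (ContinuousLinearMap.adjoint T)) A.adjoint).topologicalClosure =
      (prod A (ofCLM T)).adjoint := by
  rw [topologicalClosure_eq_adjoint_adjoint, adjoint_ofCLM_prod_adjoint hA]

theorem mk_mem_adjoint_prod_ofCLM [CompleteSpace E] [CompleteSpace F] {A : LinRel F G}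
    (T : E →L[ℂ] F) {h : G} {k : F} (hk : (h, k) ∈ A.adjoint) :
    (h, ContinuousLinearMap.adjoint T k) ∈ (prod A (ofCLM T)).adjoint := by
  refine mk_mem_adjoint.2 fun f f' hf => ?_
  rw [ContinuousLinearMap.adjoint_inner_right]
  exact mk_mem_adjoint.1 hk _ _ (mk_mem_prod_ofCLM.1 hf)

theorem IsLE.prod_ofCLM {H HA HB K : Type*}
    [NormedAddCommGroup H] [InnerProductSpace ℂ H] [CompleteSpace H]
    [NormedAddCommGroup HA] [InnerProductSpace ℂ HA] [CompleteSpace HA]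
    [NormedAddCommGroup HB] [InnerProductSpace ℂ HB] [CompleteSpace HB]
    [NormedAddCommGroup K] [InnerProductSpace ℂ K] [CompleteSpace K]
    {A : LinRel HA H} (hA : IsClosed (A : Set (HA × H)))
    {B : LinRel HB H} (hB : IsClosed (B : Set (HB × H))) {c : ℝ} (T : K →L[ℂ] HA)
    (h : IsLE (prod A A.adjoint) (scale (c ^ 2) (prod B B.adjoint))) :
    IsLE (prod (prod A (ofCLM T))
      (prod (ofCLM (ContinuousLinearMap.adjoint T)) A.adjoint).topologicalClosure)
      (scale (c ^ 2 * ‖T‖ ^ 2) (prod B B.adjoint)) := by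
  rw [← prod_dilate_adjoint hB, isLE_prod_adjoint_iff hA (isClosed_dilate c hB)] at h
  rw [topologicalClosure_ofCLM_prod_adjoint hA, ← mul_pow, ← prod_dilate_adjoint hB,
    isLE_prod_adjoint_iff (isClosed_prod_ofCLM hA T) (isClosed_dilate _ hB)]
  intro x w hw
  have bound : ∀ k, ‖ContinuousLinearMap.adjoint T k‖ ≤ ‖T‖ * ‖k‖ := fun k => by
    simpa using (ContinuousLinearMap.adjoint T).le_opNorm k
  -- For `c = 0` the old and new scales coincide, and `w = 0` forces `k = 0`.
  rcases eq_or_ne c 0 with rfl | hc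
  · rw [zero_mul] at hw
    obtain ⟨k, hk, hkw⟩ := h x w hw
    obtain rfl := (mk_mem_adjoint_dilate_zero.1 hw).2
    obtain rfl : k = 0 := by simpa using hkw
    exact ⟨_, mk_mem_adjoint_prod_ofCLM T hk, by simp⟩
  -- Here `x` is only known to lie in `(mul B)ᗮ`, perhaps outside `dom B*`, so `h` cannot be applied
  -- to it. Instead `dom B* ⊆ dom A* ⊆ (mul A)ᗮ` yields `mul A ⊆ mul B`, hence `x ⊥ mul A`.
  rcases eq_or_ne T 0 with rfl | hT
  · rw [norm_zero, mul_zero, mk_mem_adjoint_dilate_zero] at hw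
    refine ⟨0, mk_mem_adjoint.2 fun f a ha => ?_, by simp⟩
    rw [mk_mem_prod_ofCLM] at ha
    have haB : a ∈ mul B := by
      rw [← adjoint_adjoint hB, mem_mul_adjoint, Submodule.mem_orthogonal]
      intro y hy
      obtain ⟨b, hb⟩ := mem_dom.1 hy
      obtain ⟨k, hk, -⟩ := h y ((c : ℂ) • b)
        ((mk_mem_adjoint_dilate hc).2 (by rwa [inv_smul_smul₀ (by simpa using hc)]))
      have := mk_mem_adjoint.1 hk _ _ ha
      rw [zero_apply, inner_zero_left] at this
      rw [← inner_conj_symm, this, map_zero]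
    rw [inner_zero_right]
    exact (Submodule.mem_orthogonal _ _).1 hw.1 a haB
  · have hT' : ‖T‖ ≠ 0 := norm_ne_zero_iff.2 hT
    have hTc : (‖T‖ : ℂ) ≠ 0 := Complex.ofReal_ne_zero.2 hT'
    rw [mk_mem_adjoint_dilate (mul_ne_zero hc hT')] at hw
    -- Dividing by `‖T‖` turns scale `c ‖T‖` into scale `c`; the bound on `T*` restores the factor.
    obtain ⟨k, hk, hkw⟩ := h x ((‖T‖⁻¹ : ℂ) • w)
      ((mk_mem_adjoint_dilate hc).2 (by simpa [smul_smul, mul_comm] using hw))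
    refine ⟨_, mk_mem_adjoint_prod_ofCLM T hk, (bound k).trans ?_⟩
    rw [norm_smul, norm_inv, Complex.norm_real, norm_norm] at hkw
    calc ‖T‖ * ‖k‖ ≤ ‖T‖ * (‖T‖⁻¹ * ‖w‖) := by gcongr
      _ = ‖w‖ := mul_inv_cancel_left₀ hT' _

theorem scale_one (S : LinRel E E) : scale 1 S = S := by
  ext ⟨f, f'⟩
  simp [scale]

end LinRel

theorem corollary3p6
    {H HA HB K : Type*}
    [NormedAddCommGroup H] [InnerProductSpace ℂ H] [CompleteSpace H]
    [NormedAddCommGroup HA] [InnerProductSpace ℂ HA] [CompleteSpace HA]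
    [NormedAddCommGroup HB] [InnerProductSpace ℂ HB] [CompleteSpace HB]
    [NormedAddCommGroup K] [InnerProductSpace ℂ K] [CompleteSpace K]
    (A : LinRel HA H) (hA : IsClosed (A : Set (HA × H)))
    (B : LinRel HB H) (hB : IsClosed (B : Set (HB × H))) :
    (∀ c : ℝ, 0 ≤ c → ∀ T : K →L[ℂ] HA,
      LinRel.IsLE (LinRel.prod A A.adjoint) (LinRel.scale (c ^ 2) (LinRel.prod B B.adjoint)) →
      LinRel.IsLE
        (LinRel.prod (LinRel.prod A (LinRel.ofCLM T))
          (LinRel.prod (LinRel.ofCLM (ContinuousLinearMap.adjoint T))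
            A.adjoint).topologicalClosure)
        (LinRel.scale (c ^ 2 * ‖T‖ ^ 2) (LinRel.prod B B.adjoint))) ∧
    (∀ T : K →L[ℂ] HB,
      LinRel.IsLE
        (LinRel.prod (LinRel.prod B (LinRel.ofCLM T))
          (LinRel.prod (LinRel.ofCLM (ContinuousLinearMap.adjoint T))
            B.adjoint).topologicalClosure)
        (LinRel.scale (‖T‖ ^ 2) (LinRel.prod B B.adjoint))) := by
  refine ⟨fun c _ T h => h.prod_ofCLM hA hB T, fun T => ?_⟩
  -- The second claim is the first with `A = B` and `c = 1`.
  have hBB : LinRel.IsLE (LinRel.prod B B.adjoint)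
      (LinRel.scale (1 ^ 2) (LinRel.prod B B.adjoint)) := by
    rw [one_pow, LinRel.scale_one]
    exact (LinRel.isLE_prod_adjoint_iff hB hB).2 fun h w hw => ⟨w, hw, le_rfl⟩
  simpa using hBB.prod_ofCLM hB hB T
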